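/- Let $(M,g)$ be a Riemannian manifold without boundary ($M$ of class $C^4$ and $g$ of class $C^3$; in particular, any smooth Riemannian manifold). For a function $f$ on $M$ with values in $\mathbb R$ or $\mathbb C$ let $$\tau(f)=\sum_{i,j}\frac{1}{\sqrt{|g|}}\frac{\partial}{\partial x_j}\Big(g^{ij}\sqrt{|g|}\,\frac{\partial f}{\partial x_i}\Big)$$ be its Laplace-Beltrami operator (tension field), and put $\tau^0(f)=f$, $\tau^p(f)=\tau(\tau^{p-1}(f))$. A function $f$ of class $C^{2p}$ is called $p$-harmonic if $\tau^p(f)=0$, and proper $p$-harmonic if moreover $\tau^{p-1}(f)$ does not vanish identically; "biharmonic" means $2$-harmonic. A map $\phi:M\to\mathbb C$ of class $C^{4}$ is a $(2,1)$-harmonic morphism if for every open $U\subset\mathbb C$ with $\phi^{-1}(U)\neq\emptyset$ and every harmonic (i.e. $1$-harmonic) function $f:U\to\mathbb R$ the composition $f\circ\phi:\phi^{-1}(U)\to\mathbb R$ is biharmonic. Let $\phi:(M,g)\to\mathbb C$ be a submersive $(2,1)$-harmonic morphism, let $F,G:U\to\mathbb C$ be holomorphic functions on an open subset $U$ of $\mathbb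 C$ containing $\phi(M)$, and let $\psi=F+\bar G$. Then the composition $\psi\circ\phi:(M,g)\to\mathbb C$ is biharmonic. It is proper biharmonic if and only if the function $$x\mapsto F'(\phi(x))\,\tau(\phi)(x)+\overline{G'(\phi(x))\,\tau(\phi)(x)}$$ does not vanish identically on $M$. -/

import Mathlib

open scoped Bundle Manifold ContDiff ComplexConjugate

noncomputable section

namespace BiharmonicMorphism

variable {E : Type*} [NormedAddCommGroup E] [NormedSpace ℝ E] [FiniteDimensional ℝ E]
  {M : Type*} [TopologicalSpace M] [ChartedSpace E M]
  [Bundle.RiemannianBundle (fun x : M ↦ TangentSpace 𝓘(ℝ, E) x)]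
  {E' : Type*} [NormedAddCommGroup E'] [NormedSpace ℝ E'] [FiniteDimensional ℝ E']
  {N : Type*} [TopologicalSpace N] [ChartedSpace E' N]
  [Bundle.RiemannianBundle (fun x : N ↦ TangentSpace 𝓘(ℝ, E') x)]
  {V : Type*} [NormedAddCommGroup V] [NormedSpace ℝ V]

/-- The `i`-th coordinate vector field `∂/∂xᵢ` of the preferred chart at `p`, at the point of `M`
with coordinates `u`. The linear coordinates on the model space `E` are those of a fixed basis. -/
def coordField (p : M) (u : E) (i : Fin (Module.finrank ℝ E)) :
    TangentSpace 𝓘(ℝ, E) ((extChartAt 𝓘(ℝ, E) p).symm u) :=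
  mfderiv 𝓘(ℝ, E) 𝓘(ℝ, E) (extChartAt 𝓘(ℝ, E) p).symm u (Module.finBasis ℝ E i)

/-- The matrix `(gᵢⱼ)` of the Riemannian metric in the preferred chart at `p`, as a function of the
coordinates `u`. -/
def metricMatrix (p : M) (u : E) :
    Matrix (Fin (Module.finrank ℝ E)) (Fin (Module.finrank ℝ E)) ℝ :=
  Matrix.of fun i j ↦ inner ℝ (coordField p u i) (coordField p u j)

variable (E) in
/-- The Laplace-Beltrami operator (tension field)
`τ(f) = ∑ i j, (1 / √|g|) ∂/∂xⱼ (gⁱʲ √|g| ∂f/∂xᵢ)`,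
computed at each point `p` in the preferred chart at `p`. -/
def tension (f : M → V) (p : M) : V :=
  (√(metricMatrix p (extChartAt 𝓘(ℝ, E) p p)).det)⁻¹ •
    ∑ i, ∑ j,
      fderiv ℝ
        (fun u : E ↦ ((metricMatrix p u)⁻¹ i j * √(metricMatrix p u).det) •
          fderiv ℝ (f ∘ (extChartAt 𝓘(ℝ, E) p).symm) u (Module.finBasis ℝ E i))
        (extChartAt 𝓘(ℝ, E) p p) (Module.finBasis ℝ E j)

variable (E) in
/-- `f` is `p`-harmonic on the (open) set `U`: it is of class `C^{2p}` there and `τ^p(f) = 0`. -/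
def IsPHarmonicOn (p : ℕ) (f : M → V) (U : Set M) : Prop :=
  ContMDiffOn 𝓘(ℝ, E) 𝓘(ℝ, V) ((2 * p : ℕ) : ℕ∞ω) f U ∧ ∀ x ∈ U, (tension E)^[p] f x = 0

variable (E) in
/-- `f : M → V` is `p`-harmonic. -/
def IsPHarmonic (p : ℕ) (f : M → V) : Prop :=
  IsPHarmonicOn E p f Set.univ

variable (E) in
/-- `f` is proper `p`-harmonic (for `p ≥ 1`): it is `p`-harmonic and `τ^{p-1}(f)` does not vanish
identically. -/
def IsProperPHarmonic (p : ℕ) (f : M → V) : Prop :=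
  IsPHarmonic E p f ∧ ∃ x, (tension E)^[p - 1] f x ≠ 0

variable (E E') in
/-- `φ : M → N` is a `(p, q)`-harmonic morphism between Riemannian manifolds: a map of class
`C^{2p}` pulling back local real-valued `q`-harmonic functions to `p`-harmonic functions. -/
def IsHarmonicMorphism (p q : ℕ) (φ : M → N) : Prop :=
  ContMDiff 𝓘(ℝ, E) 𝓘(ℝ, E') ((2 * p : ℕ) : ℕ∞ω) φ ∧
    ∀ (U : Set N) (f : N → ℝ), IsOpen U → (φ ⁻¹' U).Nonempty →
      IsPHarmonicOn E' q f U → IsPHarmonicOn E p (f ∘ φ) (φ ⁻¹' U)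

end BiharmonicMorphism

end

namespace BiharmonicMorphism

open Filter Topology

/-! ### Determinants of linear maps and the Piola identity. -/

section Calculus

variable {E : Type*} [NormedAddCommGroup E] [NormedSpace ℝ E]
  {ι : Type*} [Fintype ι] [DecidableEq ι]

/-! The core is one test function. For holomorphic `F` the chain rule gives τ(F∘φ) = F'(φ) τ(φ) +
F''(φ) S, where S = ∑ gⁱʲ ∂ᵢφ ∂ⱼφ is `gradSq`. Real and imaginary parts of `F` are harmonic, so the
morphism property yields τ²(F∘φ) = 0. Fix p, put a = φ(p) and take F = (z - a)⁴. Then τ(F∘φ) = (φ -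
a)² h with h(p) = 12 S(p), and since (φ - a)² has a double zero at p, a second τ gives h(p) τ((φ -
a)²)(p) = 24 S(p)². Hence S = 0 (`IsHarmonicMorphism.gradSq_eq_zero`), so τ(F∘φ) = F'(φ) τ(φ).
Because τ commutes with real-linear maps, both claims for F + conj G follow from those for `F` and
`G`.

The analytic groundwork serves to iterate τ. `tension` uses a different chart at each point, so its
regularity and its second application need chart independence (`tension_eq_localLaplacian`). This
comes from writing the Laplacian as the divergence of √|g| grad f and applying the Piola identity
(`trace_fderiv_of_piola`) to the change of coordinates. -/

theorem contDiffAt_matrix_det {k : ℕ∞ω} {g : E → Matrix ι ι ℝ} {u : E}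
    (hg : ∀ i j, ContDiffAt ℝ k (fun w ↦ g w i j) u) :
    ContDiffAt ℝ k (fun w ↦ (g w).det) u := by
  simp only [Matrix.det_apply]
  refine ContDiffAt.sum fun σ _ ↦ ContDiffAt.const_smul _ ?_
  exact contDiffAt_prod fun i _ ↦ hg _ _

theorem contDiffAt_matrix_inv {k : ℕ∞ω} {g : E → Matrix ι ι ℝ} {u : E}
    (hg : ∀ i j, ContDiffAt ℝ k (fun w ↦ g w i j) u) (h0 : (g u).det ≠ 0) (i j : ι) :
    ContDiffAt ℝ k (fun w ↦ (g w)⁻¹ i j) u := by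
  simp only [Matrix.inv_def, Ring.inverse_eq_inv', Matrix.smul_apply, smul_eq_mul,
    Matrix.adjugate_apply]
  refine ((contDiffAt_matrix_det hg).inv h0).mul (contDiffAt_matrix_det fun a c ↦ ?_)
  by_cases h : a = j
  · subst h
    simp only [Matrix.updateRow_self]
    exact contDiffAt_const
  · simp only [Matrix.updateRow_ne h]
    exact hg a c

variable [FiniteDimensional ℝ E]

theorem contDiff_clm_det : ContDiff ℝ 1 (fun A : E →L[ℝ] E ↦ A.det) := by
  have h (A : E →L[ℝ] E) : A.det
      = (LinearMap.toMatrix (Module.finBasis ℝ E) (Module.finBasis ℝ E) (A : E →ₗ[ℝ] E)).det :=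
    (LinearMap.det_toMatrix _ _).symm
  simp only [h]
  refine contDiff_iff_contDiffAt.2 fun A ↦ contDiffAt_matrix_det fun i j ↦ ?_
  simp only [LinearMap.toMatrix_apply]
  let ℓ : (E →L[ℝ] E) →ₗ[ℝ] ℝ :=
    { toFun := fun B ↦ (Module.finBasis ℝ E).repr (B (Module.finBasis ℝ E j)) i
      map_add' := by intros; simp
      map_smul' := by intros; simp }
  exact ℓ.toContinuousLinearMap.contDiff.contDiffAt

/-- Jacobi's formula for the derivative of the determinant. -/
theorem fderiv_clm_det (e : E ≃L[ℝ] E) (B : E →L[ℝ] E) :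
    fderiv ℝ (fun A : E →L[ℝ] E ↦ A.det) e B
      = (e : E →L[ℝ] E).det * LinearMap.trace ℝ E ((e.symm : E →L[ℝ] E) ∘L B : E →L[ℝ] E) := by
  set b := Module.finBasis ℝ E
  have hd : HasDerivAt (fun t : ℝ ↦ ((e : E →L[ℝ] E) + t • B).det)
      (fderiv ℝ (fun A : E →L[ℝ] E ↦ A.det) e B) 0 := by
    have h1 : HasDerivAt (fun t : ℝ ↦ (e : E →L[ℝ] E) + t • B) B 0 := by
      simpa using ((hasDerivAt_id (0 : ℝ)).smul_const B).const_add (e : E →L[ℝ] E)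
    have h2 := ((contDiff_clm_det (E := E)).differentiable one_ne_zero
      (e : E →L[ℝ] E)).hasFDerivAt
    exact HasFDerivAt.comp_hasDerivAt_of_eq (0 : ℝ) h2 h1 (by simp)
  set C : Matrix _ _ ℝ := LinearMap.toMatrix b b ((e.symm : E →L[ℝ] E) ∘L B : E →L[ℝ] E) with hC
  -- Factoring out `e` moves the computation to the identity, where the linear coefficient of the
  -- determinant is the trace.
  have hdet (t : ℝ) : ((e : E →L[ℝ] E) + t • B).det = (e : E →L[ℝ] E).det * (1 + t • C).det := by
    have h1 : (e : E →L[ℝ] E) + t • B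
        = (e : E →L[ℝ] E) ∘L (ContinuousLinearMap.id ℝ E + t • ((e.symm : E →L[ℝ] E) ∘L B)) := by
      ext v; simp
    have h2 : (1 + t • C) = LinearMap.toMatrix b b
        ((ContinuousLinearMap.id ℝ E + t • ((e.symm : E →L[ℝ] E) ∘L B) : E →L[ℝ] E) :
          E →ₗ[ℝ] E) := by
      rw [ContinuousLinearMap.toLinearMap_add, ContinuousLinearMap.toLinearMap_smul, map_add,
        map_smul]
      exact congrArg (· + t • C) (LinearMap.toMatrix_one b).symm
    rw [h1, h2, LinearMap.det_toMatrix]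
    exact LinearMap.det_comp _ _
  have hd' : HasDerivAt (fun t : ℝ ↦ ((e : E →L[ℝ] E) + t • B).det)
      ((e : E →L[ℝ] E).det * C.trace) 0 := by
    simp only [hdet]
    refine HasDerivAt.const_mul _ ?_
    have hexp (t : ℝ) := Matrix.det_one_add_smul t C
    rw [funext hexp]
    set P := (1 + (Polynomial.X : Polynomial ℝ) • C.map ⇑Polynomial.C).det.divX.divX
    have h3 := ((hasDerivAt_id (0 : ℝ)).const_mul C.trace).const_add 1
    have h4 := (P.hasDerivAt 0).mul ((hasDerivAt_id (0 : ℝ)).pow 2)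
    exact (h3.add h4).congr_deriv (by simp)
  rw [hd.unique hd', LinearMap.trace_eq_matrix_trace ℝ b]

/-- The Piola identity: the Piola transform `Z = det(DT) • (DT)⁻¹ (Y ∘ T)` of a vector field `Y`
satisfies `div Z = det(DT) * (div Y) ∘ T`. -/
theorem trace_fderiv_of_piola {T Y Z : E → E} {u : E} (hT : ContDiffAt ℝ 2 T u)
    (h0 : (fderiv ℝ T u).det ≠ 0) (hZ : DifferentiableAt ℝ Z u) (hY : DifferentiableAt ℝ Y (T u))
    (h : ∀ᶠ w in 𝓝 u, fderiv ℝ T w (Z w) = (fderiv ℝ T w).det • Y (T w)) :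
    LinearMap.trace ℝ E (fderiv ℝ Z u)
      = (fderiv ℝ T u).det * LinearMap.trace ℝ E (fderiv ℝ Y (T u)) := by
  obtain ⟨e, he⟩ : ∃ e : E ≃L[ℝ] E, (e : E →L[ℝ] E) = fderiv ℝ T u :=
    ⟨(fderiv ℝ T u).toContinuousLinearEquivOfDetNeZero h0, by simp⟩
  set J := (fderiv ℝ T u).det
  have hA : HasFDerivAt (fderiv ℝ T) (fderiv ℝ (fderiv ℝ T) u) u :=
    ((hT.fderiv_right (m := 1) (by norm_num)).differentiableAt one_ne_zero).hasFDerivAt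
  set A' := fderiv ℝ (fderiv ℝ T) u
  have hTd : HasFDerivAt T (fderiv ℝ T u) u := (hT.differentiableAt two_ne_zero).hasFDerivAt
  have hJ : HasFDerivAt (fun w ↦ (fderiv ℝ T w).det)
      ((fderiv ℝ (fun A : E →L[ℝ] E ↦ A.det) (fderiv ℝ T u)) ∘L A') u :=
    ((contDiff_clm_det (E := E)).differentiable one_ne_zero _).hasFDerivAt.comp u hA
  set d := (fderiv ℝ (fun A : E →L[ℝ] E ↦ A.det) (fderiv ℝ T u)) ∘L A' with hd
  have hL := hA.clm_apply hZ.hasFDerivAt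
  have hR := hJ.smul (hY.hasFDerivAt.comp u hTd)
  have hLR := (hL.congr_of_eventuallyEq (h.mono fun w hw ↦ hw.symm)).unique hR
  -- Symmetry of D²T rewrites A'(v)(Z u) as the operator A'(Z u) applied to v, whose trace Jacobi's
  -- formula can identify.
  have hsymm : ∀ v w, A' v w = A' w v := by
    have := hT.isSymmSndFDerivAt (by simp)
    exact fun v w ↦ this v w
  have hap (v : E) : fderiv ℝ T u v = e v := by rw [← he]; rfl
  have hZu : Z u = J • e.symm (Y (T u)) := by
    rw [← map_smul, e.eq_symm_apply, ← hap]
    exact h.self_of_nhds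
  have hdZ : (fderiv ℝ Z u : E →ₗ[ℝ] E)
      = LinearMap.smulRight (d : E →ₗ[ℝ] ℝ) (e.symm (Y (T u)))
        + J • e.symm.toLinearEquiv.conj (fderiv ℝ Y (T u))
        - (((e.symm : E →L[ℝ] E) ∘L A' (Z u) : E →L[ℝ] E) : E →ₗ[ℝ] E) := by
    ext v
    have h1 := congrArg (fun L : E →L[ℝ] E ↦ e.symm (L v)) hLR
    simp only [add_apply, ContinuousLinearMap.comp_apply, hap, map_add,
      ContinuousLinearEquiv.symm_apply_apply, ContinuousLinearMap.flip_apply, hsymm v (Z u),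
      smul_apply, ContinuousLinearMap.smulRight_apply, map_smul,
      Function.comp_apply] at h1
    simp only [ContinuousLinearMap.coe_coe, LinearMap.sub_apply, LinearMap.add_apply,
      LinearMap.smulRight_apply, LinearMap.smul_apply, LinearEquiv.conj_apply_apply,
      ContinuousLinearMap.comp_apply]
    rw [eq_sub_iff_add_eq, add_comm (d v • _)]
    exact h1
  rw [hdZ, map_sub, map_add, map_smul, LinearMap.trace_smulRight, LinearMap.trace_conj']
  -- Since Z u = J e⁻¹ Y(T u), Jacobi's formula makes the two terms containing second derivatives of
  -- `T` cancel.
  have hdY : d (e.symm (Y (T u)))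
      = LinearMap.trace ℝ E (((e.symm : E →L[ℝ] E) ∘L A' (Z u) : E →L[ℝ] E) : E →ₗ[ℝ] E) := by
    rw [hd, ContinuousLinearMap.comp_apply, ← he, fderiv_clm_det, he, hZu, map_smul,
      ContinuousLinearMap.comp_smul, ContinuousLinearMap.toLinearMap_smul, map_smul, smul_eq_mul]
  simp only [ContinuousLinearMap.coe_coe, hdY]
  simp

end Calculus

/-! ### The Laplacian in coordinates and its invariance under coordinate changes. -/

section LocalLaplacian

open scoped Matrix

variable {E : Type*} [NormedAddCommGroup E] [NormedSpace ℝ E]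
  {ι : Type*} [Fintype ι] [DecidableEq ι]
  {V : Type*} [NormedAddCommGroup V] [NormedSpace ℝ V]
  {W : Type*} [NormedAddCommGroup W] [NormedSpace ℝ W]

/-- The Laplace-Beltrami operator of the Riemannian metric `g` on (an open subset of) the vector
space `E`, the matrix of `g` being taken in the basis `b`. -/
noncomputable def localLaplacian (b : Module.Basis ι ℝ E) (g : E → Matrix ι ι ℝ) (f : E → V)
    (u : E) : V :=
  (√(g u).det)⁻¹ •
    ∑ i, ∑ j, fderiv ℝ (fun w : E ↦ ((g w)⁻¹ i j * √(g w).det) • fderiv ℝ f w (b i)) u (b j)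

variable {b : Module.Basis ι ℝ E} {g : E → Matrix ι ι ℝ} {u : E}

theorem contDiffAt_sqrt_det {k : ℕ∞ω}
    (hg : ∀ i j, ContDiffAt ℝ k (fun w ↦ g w i j) u) (h0 : 0 < (g u).det) :
    ContDiffAt ℝ k (fun w ↦ √(g w).det) u :=
  (contDiffAt_matrix_det hg).sqrt h0.ne'

theorem contDiffAt_inv_mul_sqrt_det {k : ℕ∞ω}
    (hg : ∀ i j, ContDiffAt ℝ k (fun w ↦ g w i j) u) (h0 : 0 < (g u).det) (i j : ι) :
    ContDiffAt ℝ k (fun w ↦ (g w)⁻¹ i j * √(g w).det) u :=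
  (contDiffAt_matrix_inv hg h0.ne' i j).mul (contDiffAt_sqrt_det hg h0)

theorem contDiffAt_fderiv_apply {m k : ℕ∞ω} {f : E → V} (hf : ContDiffAt ℝ k f u)
    (hmk : m + 1 ≤ k) (v : E) : ContDiffAt ℝ m (fun w ↦ fderiv ℝ f w v) u :=
  (hf.fderiv_right hmk).clm_apply contDiffAt_const

theorem contDiffAt_localLaplacian {m k l : ℕ∞ω} {f : E → V} (hml : m + 1 ≤ l) (hlk : l + 1 ≤ k)
    (hg : ∀ i j, ContDiffAt ℝ l (fun w ↦ g w i j) u) (h0 : 0 < (g u).det)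
    (hf : ContDiffAt ℝ k f u) : ContDiffAt ℝ m (localLaplacian b g f) u := by
  have hml' : m ≤ l := le_self_add.trans hml
  refine (((contDiffAt_sqrt_det hg h0).of_le hml').inv (Real.sqrt_pos.2 h0).ne').smul ?_
  refine ContDiffAt.sum fun i _ ↦ ContDiffAt.sum fun j _ ↦ contDiffAt_fderiv_apply ?_ hml _
  exact (contDiffAt_inv_mul_sqrt_det hg h0 i j).smul (contDiffAt_fderiv_apply hf hlk _)

theorem localLaplacian_congr {f f' : E → V} (h : f =ᶠ[𝓝 u] f') :
    localLaplacian b g f u = localLaplacian b g f' u := by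
  unfold localLaplacian
  congr 1
  refine Finset.sum_congr rfl fun i _ ↦ Finset.sum_congr rfl fun j _ ↦ ?_
  refine congrArg (fun L : E →L[ℝ] V ↦ L (b j)) (EventuallyEq.fderiv_eq ?_)
  filter_upwards [h.fderiv (𝕜 := ℝ)] with w hw
  rw [hw]

theorem differentiableAt_flux {f : E → V}
    (hg : ∀ i j, ContDiffAt ℝ 1 (fun w ↦ g w i j) u) (h0 : 0 < (g u).det)
    (hf : ContDiffAt ℝ 2 f u) (i j : ι) : DifferentiableAt ℝ
      (fun w : E ↦ ((g w)⁻¹ i j * √(g w).det) • fderiv ℝ f w (b i)) u :=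
  ((contDiffAt_inv_mul_sqrt_det hg h0 i j).differentiableAt one_ne_zero).smul
    ((contDiffAt_fderiv_apply hf (m := 1) (by norm_num) _).differentiableAt one_ne_zero)

/-- Leaving divergence form separates the second-order part from a first-order part linear in Df,
which reduces the later chain and product rules to algebra. -/
theorem localLaplacian_eq {f : E → V}
    (hg : ∀ i j, ContDiffAt ℝ 1 (fun w ↦ g w i j) u) (h0 : 0 < (g u).det)
    (hf : ContDiffAt ℝ 2 f u) :
    localLaplacian b g f u =
      (∑ i, ∑ j, (g u)⁻¹ i j • fderiv ℝ (fderiv ℝ f) u (b j) (b i)) +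
      ∑ i, ∑ j, ((√(g u).det)⁻¹ * fderiv ℝ (fun w ↦ (g w)⁻¹ i j * √(g w).det) u (b j)) •
        fderiv ℝ f u (b i) := by
  unfold localLaplacian
  rw [Finset.smul_sum, ← Finset.sum_add_distrib]
  refine Finset.sum_congr rfl fun i _ ↦ ?_
  rw [Finset.smul_sum, ← Finset.sum_add_distrib]
  refine Finset.sum_congr rfl fun j _ ↦ ?_
  have hs : √(g u).det ≠ 0 := (Real.sqrt_pos.2 h0).ne'
  have h1 : HasFDerivAt (fderiv ℝ f) (fderiv ℝ (fderiv ℝ f) u) u :=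
    ((hf.fderiv_right (m := 1) (by norm_num)).differentiableAt one_ne_zero).hasFDerivAt
  have h2 := (((contDiffAt_inv_mul_sqrt_det hg h0 i j).differentiableAt
    one_ne_zero).hasFDerivAt).smul (h1.clm_apply (hasFDerivAt_const (b i) u))
  have h3 := congrArg (fun L : E →L[ℝ] V ↦ L (b j)) h2.fderiv
  refine (congrArg _ h3).trans ?_
  simp [smul_smul]
  field_simp

theorem localLaplacian_clm_comp {f : E → V} (ℓ : V →L[ℝ] W)
    (hg : ∀ i j, ContDiffAt ℝ 1 (fun w ↦ g w i j) u) (h0 : 0 < (g u).det)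
    (hf : ContDiffAt ℝ 2 f u) :
    localLaplacian b g (ℓ ∘ f) u = ℓ (localLaplacian b g f u) := by
  unfold localLaplacian
  simp only [map_smul, map_sum]
  congr 1
  refine Finset.sum_congr rfl fun i _ ↦ Finset.sum_congr rfl fun j _ ↦ ?_
  have h1 : (fun w : E ↦ ((g w)⁻¹ i j * √(g w).det) • fderiv ℝ (ℓ ∘ f) w (b i)) =ᶠ[𝓝 u]
      ℓ ∘ fun w : E ↦ ((g w)⁻¹ i j * √(g w).det) • fderiv ℝ f w (b i) := by
    filter_upwards [hf.eventually (by simp)] with w hw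
    have := hw.differentiableAt two_ne_zero
    rw [fderiv_comp w ℓ.differentiableAt this]
    simp
  rw [h1.fderiv_eq, fderiv_comp u ℓ.differentiableAt (differentiableAt_flux hg h0 hf i j)]
  simp

/-- The vector that the metric with matrix `G` in the basis `b` associates with the covector `d`. -/
noncomputable def sharp (b : Module.Basis ι ℝ E) (G : Matrix ι ι ℝ) (d : E →L[ℝ] ℝ) : E :=
  ∑ j, ∑ i, (G⁻¹ i j * d (b i)) • b j

/-- Naturality of the gradient: G = Jᵀ G' J with J invertible gives J G⁻¹ Jᵀ = G'⁻¹. -/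
theorem map_sharp (A : E →L[ℝ] E) (d : E →L[ℝ] ℝ) {G G' : Matrix ι ι ℝ}
    (hG : G = (LinearMap.toMatrix b b (A : E →ₗ[ℝ] E))ᵀ * G' *
      LinearMap.toMatrix b b (A : E →ₗ[ℝ] E)) (hA : A.det ≠ 0) :
    A (sharp b G (d ∘L A)) = sharp b G' d := by
  set J := LinearMap.toMatrix b b (A : E →ₗ[ℝ] E) with hJ
  have hJu : IsUnit J.det := by
    rw [hJ, LinearMap.det_toMatrix]
    exact isUnit_iff_ne_zero.2 hA
  -- No symmetry of `H` is assumed, so the transpose has to be kept.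
  have hrepr (H : Matrix ι ι ℝ) (δ : E →L[ℝ] ℝ) :
      b.equivFun (sharp b H δ) = H⁻¹ᵀ.mulVec (fun i ↦ δ (b i)) := by
    ext k
    simp only [sharp, ← Finset.sum_smul, map_sum, map_smul, Module.Basis.equivFun_self,
      Finset.sum_apply, Pi.smul_apply, smul_eq_mul, mul_ite, mul_one, mul_zero,
      Finset.sum_ite_eq', Finset.mem_univ, if_true, Matrix.mulVec, dotProduct,
      Matrix.transpose_apply]
  have hdA : (fun i ↦ (d ∘L A) (b i)) = Jᵀ.mulVec (fun i ↦ d (b i)) := by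
    ext i
    have h1 : A (b i) = ∑ k, J k i • b k := by
      conv_lhs => rw [← b.sum_equivFun (A (b i))]
      simp [hJ, LinearMap.toMatrix_apply]
    simp [h1, Matrix.mulVec, dotProduct]
  have hAm (v : E) : b.equivFun (A v) = J.mulVec (b.equivFun v) :=
    (LinearMap.toMatrix_mulVec_repr b b (A : E →ₗ[ℝ] E) v).symm
  apply b.equivFun.injective
  rw [hAm, hrepr, hrepr, hdA, Matrix.mulVec_mulVec, Matrix.mulVec_mulVec, hG,
    Matrix.mul_inv_rev, Matrix.mul_inv_rev, Matrix.transpose_mul, Matrix.transpose_mul]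
  congr 1
  have hJt : (Jᵀ)⁻¹ᵀ = J⁻¹ := by rw [← Matrix.transpose_nonsing_inv, Matrix.transpose_transpose]
  rw [hJt, Matrix.mul_assoc, Matrix.mul_assoc, ← Matrix.transpose_mul, Matrix.mul_nonsing_inv _ hJu,
    Matrix.transpose_one, Matrix.mul_one, ← Matrix.mul_assoc, Matrix.mul_nonsing_inv _ hJu,
    Matrix.one_mul]

theorem hasFDerivAt_sqrt_det_smul_sharp {f : E → ℝ}
    (hg : ∀ i j, ContDiffAt ℝ 1 (fun w ↦ g w i j) u) (h0 : 0 < (g u).det)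
    (hf : ContDiffAt ℝ 2 f u) :
    HasFDerivAt (fun w : E ↦ √(g w).det • sharp b (g w) (fderiv ℝ f w))
      (∑ j, ∑ i, (fderiv ℝ (fun w : E ↦ ((g w)⁻¹ i j * √(g w).det) •
        fderiv ℝ f w (b i)) u).smulRight (b j)) u := by
  have h1 (w : E) : √(g w).det • sharp b (g w) (fderiv ℝ f w)
      = ∑ j, ∑ i, (((g w)⁻¹ i j * √(g w).det) • fderiv ℝ f w (b i)) • b j := by
    simp only [sharp, Finset.smul_sum, smul_smul, smul_eq_mul]
    refine Finset.sum_congr rfl fun i _ ↦ Finset.sum_congr rfl fun j _ ↦ ?_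
    congr 1
    ring
  rw [funext h1]
  exact HasFDerivAt.fun_sum fun j _ ↦ HasFDerivAt.fun_sum fun i _ ↦
    (differentiableAt_flux hg h0 hf i j).hasFDerivAt.smul_const (b j)

variable [FiniteDimensional ℝ E]

/-- The double sum is a divergence, that is, a basis-free trace to which the Piola identity applies.
-/
theorem localLaplacian_eq_trace {f : E → ℝ}
    (hg : ∀ i j, ContDiffAt ℝ 1 (fun w ↦ g w i j) u) (h0 : 0 < (g u).det)
    (hf : ContDiffAt ℝ 2 f u) :
    localLaplacian b g f u = (√(g u).det)⁻¹ * LinearMap.trace ℝ E (fderiv ℝ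
      (fun w : E ↦ √(g w).det • sharp b (g w) (fderiv ℝ f w)) u) := by
  rw [(hasFDerivAt_sqrt_det_smul_sharp hg h0 hf).fderiv]
  unfold localLaplacian
  rw [Finset.sum_comm]
  simp only [ContinuousLinearMap.toLinearMap_sum, map_sum, smul_eq_mul]
  congr 1
  refine Finset.sum_congr rfl fun i _ ↦ Finset.sum_congr rfl fun j _ ↦ ?_
  exact (LinearMap.trace_smulRight _ _).symm

/-- Here √|g| = |det DT| √|g'|∘T and gradients are natural, so √|g| grad(f∘T) is, up to sign, the
Piola transform of √|g'| grad f. -/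
theorem localLaplacian_comp_of_real {g' : E → Matrix ι ι ℝ} {T : E → E} {f : E → ℝ}
    (hT : ContDiffAt ℝ 2 T u) (hg : ∀ i j, ContDiffAt ℝ 1 (fun w ↦ g w i j) u)
    (hg' : ∀ i j, ContDiffAt ℝ 1 (fun w ↦ g' w i j) (T u)) (h0 : 0 < (g u).det)
    (h0' : 0 < (g' (T u)).det) (hf : ContDiffAt ℝ 2 f (T u))
    (hgT : ∀ᶠ w in 𝓝 u, g w = (LinearMap.toMatrix b b (fderiv ℝ T w : E →ₗ[ℝ] E))ᵀ * g' (T w) *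
      LinearMap.toMatrix b b (fderiv ℝ T w : E →ₗ[ℝ] E)) :
    localLaplacian b g (f ∘ T) u = localLaplacian b g' f (T u) := by
  have hdet {w : E} (h : g w = (LinearMap.toMatrix b b (fderiv ℝ T w : E →ₗ[ℝ] E))ᵀ * g' (T w) *
      LinearMap.toMatrix b b (fderiv ℝ T w : E →ₗ[ℝ] E)) :
      (g w).det = (fderiv ℝ T w).det ^ 2 * (g' (T w)).det := by
    rw [h, Matrix.det_mul, Matrix.det_mul, Matrix.det_transpose, LinearMap.det_toMatrix]
    change (fderiv ℝ T w).det * _ * (fderiv ℝ T w).det = _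
    ring
  have hu := hdet hgT.self_of_nhds
  have hJ : (fderiv ℝ T u).det ≠ 0 := by
    intro h
    rw [h] at hu
    simp [hu] at h0
  have hJc : ContinuousAt (fun w ↦ (fderiv ℝ T w).det) u :=
    (contDiff_clm_det (E := E)).continuous.continuousAt.comp
      (hT.fderiv_right (m := 1) (by norm_num)).continuousAt
  -- σ is the sign of det DT, constant near `u`; it is absorbed into the vector field `Y` and
  -- cancels at the end.
  obtain ⟨σ, hσ0, hsign⟩ :
      ∃ σ : ℝ, σ ≠ 0 ∧ ∀ᶠ w in 𝓝 u, |(fderiv ℝ T w).det| = σ * (fderiv ℝ T w).det := by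
    rcases hJ.lt_or_gt with h | h
    · refine ⟨-1, by norm_num, ?_⟩
      filter_upwards [hJc.eventually_lt_const h] with w hw
      simp [abs_of_neg hw]
    · refine ⟨1, one_ne_zero, ?_⟩
      filter_upwards [hJc.eventually_const_lt h] with w hw
      simp [abs_of_pos hw]
  have hsqrt : ∀ᶠ w in 𝓝 u, √(g w).det = σ * (fderiv ℝ T w).det * √(g' (T w)).det := by
    filter_upwards [hsign, hgT] with w hw hw'
    rw [hdet hw', Real.sqrt_mul (sq_nonneg _), Real.sqrt_sq_eq_abs, hw]
  have hfT : ContDiffAt ℝ 2 (f ∘ T) u := hf.comp u hT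
  set Z := fun w : E ↦ √(g w).det • sharp b (g w) (fderiv ℝ (f ∘ T) w)
  set Y := fun w : E ↦ √(g' w).det • sharp b (g' w) (fderiv ℝ f w)
  have hZ : DifferentiableAt ℝ Z u :=
    (hasFDerivAt_sqrt_det_smul_sharp hg h0 hfT).differentiableAt
  have hY : DifferentiableAt ℝ Y (T u) :=
    (hasFDerivAt_sqrt_det_smul_sharp hg' h0' hf).differentiableAt
  have hZY : ∀ᶠ w in 𝓝 u, fderiv ℝ T w (Z w) = (fderiv ℝ T w).det • (σ • Y) (T w) := by
    filter_upwards [hsqrt, hgT, hT.eventually (by simp), hJc.eventually_ne hJ,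
      hT.continuousAt.eventually (hf.eventually (by simp))] with w hw hw' hTw hJw hfw
    have hfd : fderiv ℝ (f ∘ T) w = fderiv ℝ f (T w) ∘L fderiv ℝ T w :=
      fderiv_comp w (hfw.differentiableAt two_ne_zero) (hTw.differentiableAt two_ne_zero)
    simp only [Z, Y, Pi.smul_apply, map_smul, hfd, map_sharp _ _ hw' hJw, hw, smul_smul]
    congr 1
    ring
  have key := trace_fderiv_of_piola hT hJ hZ (hY.const_smul σ) hZY
  rw [fderiv_const_smul hY, ContinuousLinearMap.toLinearMap_smul, map_smul, smul_eq_mul] at key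
  rw [localLaplacian_eq_trace hg h0 hfT, localLaplacian_eq_trace hg' h0' hf, key,
    hsqrt.self_of_nhds]
  have hs : √(g' (T u)).det ≠ 0 := (Real.sqrt_pos.2 h0').ne'
  field_simp
  rfl

/-- Invariance of the Laplace-Beltrami operator under changes of coordinates. -/
theorem localLaplacian_comp {g' : E → Matrix ι ι ℝ} {T : E → E} {f : E → V}
    (hT : ContDiffAt ℝ 2 T u) (hg : ∀ i j, ContDiffAt ℝ 1 (fun w ↦ g w i j) u)
    (hg' : ∀ i j, ContDiffAt ℝ 1 (fun w ↦ g' w i j) (T u)) (h0 : 0 < (g u).det)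
    (h0' : 0 < (g' (T u)).det) (hf : ContDiffAt ℝ 2 f (T u))
    (hgT : ∀ᶠ w in 𝓝 u, g w = (LinearMap.toMatrix b b (fderiv ℝ T w : E →ₗ[ℝ] E))ᵀ * g' (T w) *
      LinearMap.toMatrix b b (fderiv ℝ T w : E →ₗ[ℝ] E)) :
    localLaplacian b g (f ∘ T) u = localLaplacian b g' f (T u) := by
  rw [SeparatingDual.eq_iff_forall_dual_eq (R := ℝ)]
  intro ℓ
  have hℓ : ContDiffAt ℝ 2 (ℓ ∘ f) (T u) := ℓ.contDiff.contDiffAt.comp (T u) hf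
  have hfT : ContDiffAt ℝ 2 (f ∘ T) u := hf.comp u hT
  have h1 := localLaplacian_clm_comp (b := b) ℓ hg h0 hfT
  have h2 := localLaplacian_clm_comp (b := b) ℓ hg' h0' hf
  have h3 := localLaplacian_comp_of_real hT hg hg' h0 h0' hℓ hgT
  rw [← h1, ← h2, ← h3, Function.comp_assoc]

end LocalLaplacian

/-! ### The Laplacian on the manifold: chart independence and regularity. -/

section Manifold

open scoped Matrix

variable {E : Type*} [NormedAddCommGroup E] [NormedSpace ℝ E] [FiniteDimensional ℝ E]
  {M : Type*} [TopologicalSpace M] [ChartedSpace E M]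
  [Bundle.RiemannianBundle (fun x : M ↦ TangentSpace 𝓘(ℝ, E) x)]
  {V : Type*} [NormedAddCommGroup V] [NormedSpace ℝ V]
  {W : Type*} [NormedAddCommGroup W] [NormedSpace ℝ W]

/-- Definitional only at the base point `p` of the chart; at nearby points `tension` refers to their
own charts. -/
theorem tension_eq_localLaplacian_self (f : M → V) (p : M) :
    tension E f p = localLaplacian (Module.finBasis ℝ E) (metricMatrix p)
      (f ∘ (extChartAt 𝓘(ℝ, E) p).symm) (extChartAt 𝓘(ℝ, E) p p) :=
  rfl

variable [IsManifold 𝓘(ℝ, E) 1 M]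

omit [FiniteDimensional ℝ E] [Bundle.RiemannianBundle (fun x : M ↦ TangentSpace 𝓘(ℝ, E) x)]
  [IsManifold 𝓘(ℝ, E) 1 M] in
theorem contMDiffAt_extChartAt_symm {k : ℕ∞ω} [IsManifold 𝓘(ℝ, E) k M] {p : M} {u : E}
    (hu : u ∈ (extChartAt 𝓘(ℝ, E) p).target) :
    ContMDiffAt 𝓘(ℝ, E) 𝓘(ℝ, E) k (extChartAt 𝓘(ℝ, E) p).symm u :=
  (contMDiffOn_extChartAt_symm p).contMDiffAt ((isOpen_extChartAt_target p).mem_nhds hu)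

omit [Bundle.RiemannianBundle (fun x : M ↦ TangentSpace 𝓘(ℝ, E) x)] in
theorem linearIndependent_coordField {p : M} {u : E} (hu : u ∈ (extChartAt 𝓘(ℝ, E) p).target) :
    LinearIndependent ℝ (coordField (E := E) p u) := by
  have h := isInvertible_mfderivWithin_extChartAt_symm (I := 𝓘(ℝ, E)) hu
  rw [modelWithCornersSelf_coe, Set.range_id, mfderivWithin_univ] at h
  exact (Module.finBasis ℝ E).linearIndependent.map_injOn _ h.injective.injOn

theorem det_metricMatrix_pos {p : M} {u : E} (hu : u ∈ (extChartAt 𝓘(ℝ, E) p).target) :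
    0 < (metricMatrix (E := E) p u).det := by
  have h0 := linearIndependent_coordField hu
  have h1 : (Matrix.gram ℝ (coordField (E := E) p u)).PosDef :=
    Matrix.posDef_gram_of_linearIndependent (E := TangentSpace 𝓘(ℝ, E) ((extChartAt 𝓘(ℝ, E) p).symm u)) h0
  have h2 : metricMatrix (E := E) p u = Matrix.gram ℝ (coordField (E := E) p u) := rfl
  rw [h2]
  exact h1.det_pos

/-- Coordinate fields of a C⁴ chart lose one derivative, which matches the C³ metric. -/
theorem contDiffAt_metricMatrix [IsManifold 𝓘(ℝ, E) 4 M]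
    [IsContMDiffRiemannianBundle 𝓘(ℝ, E) 3 E (fun x : M ↦ TangentSpace 𝓘(ℝ, E) x)]
    {p : M} {u : E} (hu : u ∈ (extChartAt 𝓘(ℝ, E) p).target)
    (i j : Fin (Module.finrank ℝ E)) :
    ContDiffAt ℝ 3 (fun w ↦ metricMatrix (E := E) p w i j) u := by
  have key (i : Fin (Module.finrank ℝ E)) : ContMDiffAt 𝓘(ℝ, E) (𝓘(ℝ, E).prod 𝓘(ℝ, E)) 3
      (fun w ↦ (⟨(extChartAt 𝓘(ℝ, E) p).symm w, coordField p w i⟩ :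
        TangentBundle 𝓘(ℝ, E) M)) u := by
    have ho := isOpen_extChartAt_target (I := 𝓘(ℝ, E)) p
    have h1 := (contMDiffOn_extChartAt_symm (I := 𝓘(ℝ, E)) (n := 4) p).contMDiffOn_tangentMapWithin
      (m := 3) (by norm_num) ho.uniqueMDiffOn
    have h2 : ContMDiffAt 𝓘(ℝ, E) (𝓘(ℝ, E).prod 𝓘(ℝ, E)) 3
        (fun w ↦ (⟨w, Module.finBasis ℝ E i⟩ : TangentBundle 𝓘(ℝ, E) E)) u := by
      rw [Bundle.contMDiffAt_totalSpace]
      refine ⟨contMDiffAt_id, ?_⟩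
      simp
      exact contMDiffAt_const
    have h3 := (h1.contMDiffAt (x := ⟨u, Module.finBasis ℝ E i⟩) ?_).comp u h2
    · refine h3.congr_of_eventuallyEq ?_
      filter_upwards [ho.mem_nhds hu] with w hw
      simp only [Function.comp_apply, tangentMapWithin, coordField,
        mfderivWithin_of_mem_nhds (ho.mem_nhds hw)]
    · exact (ho.preimage (FiberBundle.continuous_proj E (TangentSpace 𝓘(ℝ, E)))).mem_nhds hu
  have h := ContMDiffAt.inner_bundle (IB := 𝓘(ℝ, E)) (n := 3) (F := E)
    (E := fun x : M ↦ TangentSpace 𝓘(ℝ, E) x) (b := (extChartAt 𝓘(ℝ, E) p).symm)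
    (v := fun w ↦ coordField p w i) (w := fun w ↦ coordField p w j) (key i) (key j)
  exact h.contDiffAt

omit [FiniteDimensional ℝ E] [IsManifold 𝓘(ℝ, E) 1 M] in
-- All tangent spaces unfold to `E`, but the inner product depends on the base point and must be
-- transported.
theorem inner_tangentSpace_congr {x y : M} (hxy : x = y) (v w : E) :
    @inner ℝ (TangentSpace 𝓘(ℝ, E) x) _ v w = @inner ℝ (TangentSpace 𝓘(ℝ, E) y) _ v w := by
  subst hxy
  rfl

omit [IsManifold 𝓘(ℝ, E) 1 M] in
-- The matrix of `A` expresses one coordinate frame in the other, so the Gram matrices are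
-- congruent.
theorem metricMatrix_eq_of_mfderiv_eq {p q : M} {u v : E} {A : E →L[ℝ] E}
    (hxy : (extChartAt 𝓘(ℝ, E) p).symm u = (extChartAt 𝓘(ℝ, E) q).symm v)
    (h : (mfderiv 𝓘(ℝ, E) 𝓘(ℝ, E) (extChartAt 𝓘(ℝ, E) p).symm u : E →L[ℝ] E) =
      (mfderiv 𝓘(ℝ, E) 𝓘(ℝ, E) (extChartAt 𝓘(ℝ, E) q).symm v : E →L[ℝ] E) ∘L A) :
    metricMatrix (E := E) p u =
      (LinearMap.toMatrix (Module.finBasis ℝ E) (Module.finBasis ℝ E) (A : E →ₗ[ℝ] E))ᵀ *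
      metricMatrix q v *
      LinearMap.toMatrix (Module.finBasis ℝ E) (Module.finBasis ℝ E) (A : E →ₗ[ℝ] E) := by
  set b := Module.finBasis ℝ E
  set J := LinearMap.toMatrix b b (A : E →ₗ[ℝ] E) with hJ
  have hA (i) : A (b i) = ∑ k, J k i • b k := by
    conv_lhs => rw [← b.sum_equivFun (A (b i))]
    simp [hJ, LinearMap.toMatrix_apply]
  have hc (i) : (coordField p u i : E) = (∑ k, J k i • coordField q v k :
      TangentSpace 𝓘(ℝ, E) ((extChartAt 𝓘(ℝ, E) q).symm v)) := by
    refine (congrArg (fun L : E →L[ℝ] E ↦ L (b i)) h).trans ?_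
    refine (congrArg (mfderiv 𝓘(ℝ, E) 𝓘(ℝ, E) (extChartAt 𝓘(ℝ, E) q).symm v) (hA i)).trans ?_
    exact (map_sum _ _ _).trans (Finset.sum_congr rfl fun k _ ↦ map_smul _ _ _)
  ext i j
  have h1 : metricMatrix (E := E) p u i j = inner ℝ
      (∑ k, J k i • coordField q v k : TangentSpace 𝓘(ℝ, E) ((extChartAt 𝓘(ℝ, E) q).symm v))
      (∑ k, J k j • coordField q v k : TangentSpace 𝓘(ℝ, E) ((extChartAt 𝓘(ℝ, E) q).symm v)) := by
    rw [← hc, ← hc]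
    exact inner_tangentSpace_congr hxy _ _
  rw [h1]
  simp only [sum_inner, inner_sum, real_inner_smul_left, real_inner_smul_right, Matrix.mul_apply,
    Matrix.transpose_apply, Finset.sum_mul]
  refine Finset.sum_congr rfl fun k _ ↦ Finset.sum_congr rfl fun l _ ↦ ?_
  change _ = J l i * inner ℝ (coordField (E := E) q v l) (coordField q v k) * J k j
  ring

omit [FiniteDimensional ℝ E] [Bundle.RiemannianBundle (fun x : M ↦ TangentSpace 𝓘(ℝ, E) x)]
  [IsManifold 𝓘(ℝ, E) 1 M] in
theorem contDiffAt_extChartAt_coordChange {k : ℕ∞ω} [IsManifold 𝓘(ℝ, E) k M] {p q : M} {u : E}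
    (hu : u ∈ (extChartAt 𝓘(ℝ, E) p).target)
    (huq : (extChartAt 𝓘(ℝ, E) p).symm u ∈ (extChartAt 𝓘(ℝ, E) q).source) :
    ContDiffAt ℝ k (extChartAt 𝓘(ℝ, E) q ∘ (extChartAt 𝓘(ℝ, E) p).symm) u := by
  rw [extChartAt_source] at huq
  exact ((contMDiffAt_extChartAt' huq).comp u (contMDiffAt_extChartAt_symm hu)).contDiffAt

theorem metricMatrix_coordChange {p q : M} {u : E}
    (hu : u ∈ (extChartAt 𝓘(ℝ, E) p).target)
    (huq : (extChartAt 𝓘(ℝ, E) p).symm u ∈ (extChartAt 𝓘(ℝ, E) q).source) :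
    metricMatrix (E := E) p u =
      (LinearMap.toMatrix (Module.finBasis ℝ E) (Module.finBasis ℝ E) (fderiv ℝ
        (extChartAt 𝓘(ℝ, E) q ∘ (extChartAt 𝓘(ℝ, E) p).symm) u : E →ₗ[ℝ] E))ᵀ *
      metricMatrix q (extChartAt 𝓘(ℝ, E) q ((extChartAt 𝓘(ℝ, E) p).symm u)) *
      LinearMap.toMatrix (Module.finBasis ℝ E) (Module.finBasis ℝ E) (fderiv ℝ
        (extChartAt 𝓘(ℝ, E) q ∘ (extChartAt 𝓘(ℝ, E) p).symm) u : E →ₗ[ℝ] E) := by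
  refine metricMatrix_eq_of_mfderiv_eq ((extChartAt 𝓘(ℝ, E) q).left_inv huq).symm ?_
  set T := extChartAt 𝓘(ℝ, E) q ∘ (extChartAt 𝓘(ℝ, E) p).symm
  have hT : DifferentiableAt ℝ T u :=
    (contDiffAt_extChartAt_coordChange (k := 1) hu huq).differentiableAt one_ne_zero
  have hsp : ContMDiffAt 𝓘(ℝ, E) 𝓘(ℝ, E) 1 (extChartAt 𝓘(ℝ, E) p).symm u :=
    contMDiffAt_extChartAt_symm hu
  have hsq : MDifferentiableAt 𝓘(ℝ, E) 𝓘(ℝ, E) (extChartAt 𝓘(ℝ, E) q).symm (T u) :=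
    (contMDiffAt_extChartAt_symm (k := 1)
      ((extChartAt 𝓘(ℝ, E) q).map_source huq)).mdifferentiableAt one_ne_zero
  have heq : (extChartAt 𝓘(ℝ, E) p).symm =ᶠ[𝓝 u] (extChartAt 𝓘(ℝ, E) q).symm ∘ T := by
    filter_upwards [hsp.continuousAt.eventually (extChartAt_source_mem_nhds' huq)] with w hw
    exact ((extChartAt 𝓘(ℝ, E) q).left_inv hw).symm
  have h1 := heq.mfderiv_eq (I := 𝓘(ℝ, E)) (I' := 𝓘(ℝ, E))
  refine h1.trans ((mfderiv_comp u hsq hT.mdifferentiableAt).trans ?_)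
  rw [mfderiv_eq_fderiv]
  rfl

variable [IsManifold 𝓘(ℝ, E) 4 M]
  [IsContMDiffRiemannianBundle 𝓘(ℝ, E) 3 E (fun x : M ↦ TangentSpace 𝓘(ℝ, E) x)]

omit [FiniteDimensional ℝ E] [Bundle.RiemannianBundle (fun x : M ↦ TangentSpace 𝓘(ℝ, E) x)]
  [IsContMDiffRiemannianBundle 𝓘(ℝ, E) 3 E (fun x : M ↦ TangentSpace 𝓘(ℝ, E) x)]
  [IsManifold 𝓘(ℝ, E) 1 M] in
theorem contDiffAt_comp_extChartAt_symm {k : ℕ∞ω} (hk : k ≤ 4) {f : M → V} {p q : M}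
    (hq : q ∈ (extChartAt 𝓘(ℝ, E) p).source) (hf : ContMDiffAt 𝓘(ℝ, E) 𝓘(ℝ, V) k f q) :
    ContDiffAt ℝ k (f ∘ (extChartAt 𝓘(ℝ, E) p).symm) (extChartAt 𝓘(ℝ, E) p q) := by
  have hs := (contMDiffAt_extChartAt_symm (k := 4) ((extChartAt 𝓘(ℝ, E) p).map_source hq)).of_le hk
  exact (ContMDiffAt.comp_of_eq hf hs ((extChartAt 𝓘(ℝ, E) p).left_inv hq)).contDiffAt

/-- The Laplace-Beltrami operator can be computed in any preferred chart. -/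
theorem tension_eq_localLaplacian {f : M → V} {p q : M} (hq : q ∈ (extChartAt 𝓘(ℝ, E) p).source)
    (hf : ContMDiffAt 𝓘(ℝ, E) 𝓘(ℝ, V) 2 f q) :
    tension E f q = localLaplacian (Module.finBasis ℝ E) (metricMatrix p)
      (f ∘ (extChartAt 𝓘(ℝ, E) p).symm) (extChartAt 𝓘(ℝ, E) p q) := by
  have hu := (extChartAt 𝓘(ℝ, E) p).map_source hq
  have hleft := (extChartAt 𝓘(ℝ, E) p).left_inv hq
  set u := extChartAt 𝓘(ℝ, E) p q
  have hqq := mem_extChartAt_source (I := 𝓘(ℝ, E)) q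
  have huq : (extChartAt 𝓘(ℝ, E) p).symm u ∈ (extChartAt 𝓘(ℝ, E) q).source := by rwa [hleft]
  set T := extChartAt 𝓘(ℝ, E) q ∘ (extChartAt 𝓘(ℝ, E) p).symm with hT
  have hTu : T u = extChartAt 𝓘(ℝ, E) q q := congrArg _ hleft
  have hTt : T u ∈ (extChartAt 𝓘(ℝ, E) q).target := (extChartAt 𝓘(ℝ, E) q).map_source huq
  have hev : ∀ᶠ w in 𝓝 u, w ∈ (extChartAt 𝓘(ℝ, E) p).target ∧
      (extChartAt 𝓘(ℝ, E) p).symm w ∈ (extChartAt 𝓘(ℝ, E) q).source :=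
    ((isOpen_extChartAt_target p).eventually_mem hu).and
      ((contMDiffAt_extChartAt_symm (k := 1) hu).continuousAt.eventually
        (extChartAt_source_mem_nhds' huq))
  have h13 : (1 : ℕ∞ω) ≤ 3 := by norm_cast
  have h24 : (2 : ℕ∞ω) ≤ 4 := by norm_cast
  have key := localLaplacian_comp (b := Module.finBasis ℝ E) (g := metricMatrix p)
    (g' := metricMatrix q) (T := T) (u := u) (f := f ∘ (extChartAt 𝓘(ℝ, E) q).symm)
    ((contDiffAt_extChartAt_coordChange (k := 4) hu huq).of_le h24)
    (fun i j ↦ (contDiffAt_metricMatrix hu i j).of_le h13)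
    (fun i j ↦ (contDiffAt_metricMatrix hTt i j).of_le h13)
    (det_metricMatrix_pos hu) (det_metricMatrix_pos hTt)
    (by rw [hTu]; exact contDiffAt_comp_extChartAt_symm h24 hqq hf)
    (hev.mono fun w hw ↦ metricMatrix_coordChange hw.1 hw.2)
  rw [tension_eq_localLaplacian_self, ← hTu, ← key]
  refine localLaplacian_congr ?_
  filter_upwards [hev] with w hw
  exact congrArg f ((extChartAt 𝓘(ℝ, E) q).left_inv hw.2)

/-- By chart independence a single chart computes τ(f) near `p`; this regularity is what permits a
second application of τ. -/
theorem contMDiff_tension {f : M → V} (hf : ContMDiff 𝓘(ℝ, E) 𝓘(ℝ, V) 4 f) :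
    ContMDiff 𝓘(ℝ, E) 𝓘(ℝ, V) 2 (tension E f) := by
  intro p
  have hp := mem_extChartAt_source (I := 𝓘(ℝ, E)) p
  have h24 : (2 : ℕ∞ω) ≤ 4 := by norm_cast
  have h1 : tension E f =ᶠ[𝓝 p] localLaplacian (Module.finBasis ℝ E) (metricMatrix p)
      (f ∘ (extChartAt 𝓘(ℝ, E) p).symm) ∘ extChartAt 𝓘(ℝ, E) p := by
    filter_upwards [extChartAt_source_mem_nhds (I := 𝓘(ℝ, E)) p] with q hq
    exact tension_eq_localLaplacian hq ((hf q).of_le h24)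
  have hu := (extChartAt 𝓘(ℝ, E) p).map_source hp
  have h2 : ContDiffAt ℝ 2 (localLaplacian (Module.finBasis ℝ E) (metricMatrix p)
      (f ∘ (extChartAt 𝓘(ℝ, E) p).symm)) (extChartAt 𝓘(ℝ, E) p p) :=
    contDiffAt_localLaplacian (l := 3) (k := 4) (by norm_num) (by norm_num)
      (contDiffAt_metricMatrix hu) (det_metricMatrix_pos hu)
      (contDiffAt_comp_extChartAt_symm le_rfl hp (hf p))
  have h3 : ContMDiffAt 𝓘(ℝ, E) 𝓘(ℝ, E) 2 (extChartAt 𝓘(ℝ, E) p) p :=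
    (contMDiffAt_extChartAt (n := 4)).of_le h24
  exact (h2.contMDiffAt.comp p h3).congr_of_eventuallyEq h1

theorem tension_clm_comp {f : M → V} (ℓ : V →L[ℝ] W) {p : M}
    (hf : ContMDiffAt 𝓘(ℝ, E) 𝓘(ℝ, V) 2 f p) :
    tension E (ℓ ∘ f) p = ℓ (tension E f p) := by
  have hu := mem_extChartAt_target (I := 𝓘(ℝ, E)) p
  exact localLaplacian_clm_comp (f := f ∘ (extChartAt 𝓘(ℝ, E) p).symm) ℓ
    (fun i j ↦ (contDiffAt_metricMatrix hu i j).of_le (by norm_cast)) (det_metricMatrix_pos hu)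
    (contDiffAt_comp_extChartAt_symm (by norm_cast) (mem_extChartAt_source p) hf)

end Manifold

/-! ### Chain rule and double-zero product rule in coordinates. -/

section ChainRule

variable {E : Type*} [NormedAddCommGroup E] [NormedSpace ℝ E]
  {ι : Type*} [Fintype ι] [DecidableEq ι]
  {b : Module.Basis ι ℝ E} {g : E → Matrix ι ι ℝ} {u : E}

theorem analyticAt_contDiffAt_real {F : ℂ → ℂ} {z : ℂ} (hF : AnalyticAt ℂ F z) {k : ℕ∞ω} :
    ContDiffAt ℝ k F z :=
  hF.contDiffAt.restrict_scalars ℝ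

theorem fderiv_fderiv_comp_analytic {F : ℂ → ℂ} {f : E → ℂ} (hF : AnalyticAt ℂ F (f u))
    (hf : ContDiffAt ℝ 2 f u) (v w : E) :
    fderiv ℝ (fderiv ℝ (F ∘ f)) u v w = deriv F (f u) * fderiv ℝ (fderiv ℝ f) u v w +
      deriv (deriv F) (f u) * (fderiv ℝ f u v * fderiv ℝ f u w) := by
  have h1 : fderiv ℝ (F ∘ f) =ᶠ[𝓝 u] fun y ↦ deriv F (f y) • fderiv ℝ f y := by
    filter_upwards [hf.eventually (by simp),
      hf.continuousAt.eventually hF.eventually_analyticAt] with y hy hFy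
    exact (hFy.differentiableAt.hasDerivAt.comp_hasFDerivAt y
      (hy.differentiableAt two_ne_zero).hasFDerivAt).fderiv
  have h2 : HasFDerivAt (fun y ↦ deriv F (f y)) (deriv (deriv F) (f u) • fderiv ℝ f u) u :=
    hF.deriv.differentiableAt.hasDerivAt.comp_hasFDerivAt u
      (hf.differentiableAt two_ne_zero).hasFDerivAt
  have h3 : HasFDerivAt (fderiv ℝ f) (fderiv ℝ (fderiv ℝ f) u) u :=
    ((hf.fderiv_right (m := 1) (by norm_num)).differentiableAt one_ne_zero).hasFDerivAt
  have h4 : HasFDerivAt (fun y ↦ deriv F (f y) • fderiv ℝ f y) _ u := h2.smul h3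
  rw [h1.fderiv_eq, h4.fderiv]
  simp [mul_assoc]

theorem fderiv_fderiv_mul_of_eq_zero {f h : E → ℂ} (hf : ContDiffAt ℝ 2 f u)
    (hh : ContDiffAt ℝ 2 h u) (h0 : f u = 0) (h1 : fderiv ℝ f u = 0) (v w : E) :
    fderiv ℝ (fderiv ℝ (f * h)) u v w = h u * fderiv ℝ (fderiv ℝ f) u v w := by
  have e1 : fderiv ℝ (f * h) =ᶠ[𝓝 u] fun y ↦ f y • fderiv ℝ h y + h y • fderiv ℝ f y := by
    filter_upwards [hf.eventually (by simp), hh.eventually (by simp)] with y hy hy'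
    exact fderiv_mul (hy.differentiableAt two_ne_zero) (hy'.differentiableAt two_ne_zero)
  have d (k : E → ℂ) (hk : ContDiffAt ℝ 2 k u) :
      HasFDerivAt (fderiv ℝ k) (fderiv ℝ (fderiv ℝ k) u) u :=
    ((hk.fderiv_right (m := 1) (by norm_num)).differentiableAt one_ne_zero).hasFDerivAt
  have hfd := (hf.differentiableAt two_ne_zero).hasFDerivAt
  have hhd := (hh.differentiableAt two_ne_zero).hasFDerivAt
  have e2 : HasFDerivAt (fun y ↦ f y • fderiv ℝ h y + h y • fderiv ℝ f y) _ u :=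
    (hfd.smul (d h hh)).add (hhd.smul (d f hf))
  rw [e1.fderiv_eq, e2.fderiv]
  simp [h0, h1]

theorem localLaplacian_comp_analytic {F : ℂ → ℂ} {f : E → ℂ}
    (hg : ∀ i j, ContDiffAt ℝ 1 (fun w ↦ g w i j) u) (h0 : 0 < (g u).det)
    (hF : AnalyticAt ℂ F (f u)) (hf : ContDiffAt ℝ 2 f u) :
    localLaplacian b g (F ∘ f) u = deriv F (f u) * localLaplacian b g f u +
      deriv (deriv F) (f u) *
        ∑ i, ∑ j, (g u)⁻¹ i j • (fderiv ℝ f u (b j) * fderiv ℝ f u (b i)) := by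
  have hFf : ContDiffAt ℝ 2 (F ∘ f) u := (analyticAt_contDiffAt_real hF).comp u hf
  have h1 : fderiv ℝ (F ∘ f) u = deriv F (f u) • fderiv ℝ f u :=
    (hF.differentiableAt.hasDerivAt.comp_hasFDerivAt u
      (hf.differentiableAt two_ne_zero).hasFDerivAt).fderiv
  rw [localLaplacian_eq hg h0 hFf, localLaplacian_eq hg h0 hf]
  simp only [fderiv_fderiv_comp_analytic hF hf, h1, smul_add, Finset.sum_add_distrib, mul_add,
    Finset.mul_sum, mul_smul_comm, smul_apply, smul_eq_mul]
  ring

/-- At a double zero of `f` the only surviving second-order term is h D²f, so no derivative of `h`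
enters. -/
theorem localLaplacian_mul_of_eq_zero {f h : E → ℂ}
    (hg : ∀ i j, ContDiffAt ℝ 1 (fun w ↦ g w i j) u) (hd : 0 < (g u).det)
    (hf : ContDiffAt ℝ 2 f u) (hh : ContDiffAt ℝ 2 h u) (h0 : f u = 0) (h1 : fderiv ℝ f u = 0) :
    localLaplacian b g (f * h) u = h u * localLaplacian b g f u := by
  have h2 : fderiv ℝ (f * h) u = 0 := by
    rw [fderiv_mul (hf.differentiableAt two_ne_zero) (hh.differentiableAt two_ne_zero)]
    ext v
    simp [h0, h1]
  have hfh : ContDiffAt ℝ 2 (f * h) u := hf.mul hh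
  rw [localLaplacian_eq hg hd hfh, localLaplacian_eq hg hd hf]
  simp [fderiv_fderiv_mul_of_eq_zero hf hh h0 h1, h1, h2, Finset.mul_sum]
  refine Finset.sum_congr rfl fun i _ ↦ Finset.sum_congr rfl fun j _ ↦ ?_
  ring

end ChainRule

/-! ### Chain rule on the manifold and the square of the gradient. -/

section Manifold

variable {E : Type*} [NormedAddCommGroup E] [NormedSpace ℝ E] [FiniteDimensional ℝ E]
  {M : Type*} [TopologicalSpace M] [ChartedSpace E M]
  [Bundle.RiemannianBundle (fun x : M ↦ TangentSpace 𝓘(ℝ, E) x)]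
  {V : Type*} [NormedAddCommGroup V] [NormedSpace ℝ V]
  {W : Type*} [NormedAddCommGroup W] [NormedSpace ℝ W]

variable (E) in
/-- The complex bilinear square `∑ i j, gⁱʲ ∂φ/∂xᵢ ∂φ/∂xⱼ` of the gradient of `φ`. It vanishes
where `φ` is horizontally weakly conformal. -/
noncomputable def gradSq (φ : M → ℂ) (p : M) : ℂ :=
  ∑ i, ∑ j, (metricMatrix p (extChartAt 𝓘(ℝ, E) p p))⁻¹ i j •
    (fderiv ℝ (φ ∘ (extChartAt 𝓘(ℝ, E) p).symm) (extChartAt 𝓘(ℝ, E) p p) (Module.finBasis ℝ E j) *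
      fderiv ℝ (φ ∘ (extChartAt 𝓘(ℝ, E) p).symm) (extChartAt 𝓘(ℝ, E) p p) (Module.finBasis ℝ E i))

variable [IsManifold 𝓘(ℝ, E) 1 M] [IsManifold 𝓘(ℝ, E) 4 M]
  [IsContMDiffRiemannianBundle 𝓘(ℝ, E) 3 E (fun x : M ↦ TangentSpace 𝓘(ℝ, E) x)]

theorem tension_comp_analytic {φ : M → ℂ} {F : ℂ → ℂ} {p : M}
    (hφ : ContMDiffAt 𝓘(ℝ, E) 𝓘(ℝ, ℂ) 2 φ p) (hF : AnalyticAt ℂ F (φ p)) :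
    tension E (F ∘ φ) p =
      deriv F (φ p) * tension E φ p + deriv (deriv F) (φ p) * gradSq E φ p := by
  have hu := mem_extChartAt_target (I := 𝓘(ℝ, E)) p
  have hp : (φ ∘ (extChartAt 𝓘(ℝ, E) p).symm) (extChartAt 𝓘(ℝ, E) p p) = φ p := by simp
  have h := localLaplacian_comp_analytic (b := Module.finBasis ℝ E)
    (f := φ ∘ (extChartAt 𝓘(ℝ, E) p).symm)
    (fun i j ↦ (contDiffAt_metricMatrix hu i j).of_le (by norm_cast)) (det_metricMatrix_pos hu)
    (by rwa [hp])
    (contDiffAt_comp_extChartAt_symm (by norm_cast) (mem_extChartAt_source p) hφ)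
  rw [hp] at h
  exact h

theorem tension_comp_analytic_mul {φ h : M → ℂ} {F : ℂ → ℂ} {p : M}
    (hφ : ContMDiffAt 𝓘(ℝ, E) 𝓘(ℝ, ℂ) 2 φ p) (hh : ContMDiffAt 𝓘(ℝ, E) 𝓘(ℝ, ℂ) 2 h p)
    (hF : AnalyticAt ℂ F (φ p)) (h0 : F (φ p) = 0) (h1 : deriv F (φ p) = 0) :
    tension E ((F ∘ φ) * h) p = h p * tension E (F ∘ φ) p := by
  have hu := mem_extChartAt_target (I := 𝓘(ℝ, E)) p
  have hs := mem_extChartAt_source (I := 𝓘(ℝ, E)) p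
  have hp (f : M → ℂ) : (f ∘ (extChartAt 𝓘(ℝ, E) p).symm) (extChartAt 𝓘(ℝ, E) p p) = f p := by
    simp
  have hφ' := contDiffAt_comp_extChartAt_symm (by norm_cast) hs hφ
  have hF' : AnalyticAt ℂ F ((φ ∘ (extChartAt 𝓘(ℝ, E) p).symm) (extChartAt 𝓘(ℝ, E) p p)) := by
    rwa [hp]
  have key := localLaplacian_mul_of_eq_zero (b := Module.finBasis ℝ E)
    (f := F ∘ φ ∘ (extChartAt 𝓘(ℝ, E) p).symm) (h := h ∘ (extChartAt 𝓘(ℝ, E) p).symm)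
    (fun i j ↦ (contDiffAt_metricMatrix hu i j).of_le (by norm_cast)) (det_metricMatrix_pos hu)
    ((analyticAt_contDiffAt_real hF').comp _ hφ')
    (contDiffAt_comp_extChartAt_symm (by norm_cast) hs hh)
    ((congrArg F (hp φ)).trans h0)
    (by
      rw [(hF'.differentiableAt.hasDerivAt.comp_hasFDerivAt _
        (hφ'.differentiableAt two_ne_zero).hasFDerivAt).fderiv, hp, h1]
      ext v
      simp)
  rw [hp] at key
  exact key

theorem tension_prodMk {f : M → V} {h : M → W} {p : M} (hf : ContMDiffAt 𝓘(ℝ, E) 𝓘(ℝ, V) 2 f p)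
    (hh : ContMDiffAt 𝓘(ℝ, E) 𝓘(ℝ, W) 2 h p) :
    tension E (fun x ↦ (f x, h x)) p = (tension E f p, tension E h p) := by
  have hfh : ContMDiffAt 𝓘(ℝ, E) 𝓘(ℝ, V × W) 2 (fun x ↦ (f x, h x)) p := hf.prodMk_space hh
  exact Prod.ext (tension_clm_comp (ContinuousLinearMap.fst ℝ V W) hfh).symm
    (tension_clm_comp (ContinuousLinearMap.snd ℝ V W) hfh).symm

/-- The chain rule for z² expresses `gradSq` through `tension`, so its regularity is inherited
without another change of charts. -/
theorem gradSq_eq_tension_sq {φ : M → ℂ} {p : M} (hφ : ContMDiffAt 𝓘(ℝ, E) 𝓘(ℝ, ℂ) 2 φ p) :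
    gradSq E φ p = 2⁻¹ * tension E ((fun z ↦ z ^ 2) ∘ φ) p - φ p * tension E φ p := by
  have h1 : deriv (fun z : ℂ ↦ z ^ 2) = fun z ↦ 2 * z := by ext z; simp
  have h2 : deriv (fun z : ℂ ↦ 2 * z) = fun _ ↦ 2 := by ext z; simp
  rw [tension_comp_analytic hφ (by fun_prop), h1, h2]
  ring

theorem contMDiff_gradSq {φ : M → ℂ} (hφ : ContMDiff 𝓘(ℝ, E) 𝓘(ℝ, ℂ) 4 φ) :
    ContMDiff 𝓘(ℝ, E) 𝓘(ℝ, ℂ) 2 (gradSq E φ) := by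
  have h24 : (2 : ℕ∞ω) ≤ 4 := by norm_cast
  have h1 : gradSq E φ =
      fun p ↦ 2⁻¹ * tension E ((fun z ↦ z ^ 2) ∘ φ) p - φ p * tension E φ p :=
    funext fun p ↦ gradSq_eq_tension_sq ((hφ p).of_le h24)
  have h2 : ContMDiff 𝓘(ℝ, E) 𝓘(ℝ, ℂ) 4 ((fun z ↦ z ^ 2) ∘ φ) :=
    (ContDiff.contMDiff (by fun_prop)).comp hφ
  rw [h1]
  have h3 : ContDiff ℝ 2 (fun x : ℂ × ℂ × ℂ ↦ 2⁻¹ * x.1 - x.2.1 * x.2.2) := by fun_prop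
  exact h3.contMDiff.comp ((contMDiff_tension h2).prodMk_space
    ((hφ.of_le h24).prodMk_space (contMDiff_tension hφ)))

end Manifold

/-! ### Holomorphic functions are harmonic on the plane. -/

section Complex

/-- The chart is the identity, but the basis `Module.finBasis ℝ ℂ` is unspecified, so the metric is
a constant Gram matrix rather than the identity matrix. -/
theorem metricMatrix_complex (z u : ℂ) :
    metricMatrix z u = Matrix.gram ℝ (Module.finBasis ℝ ℂ) := by
  ext i j
  have h (k) : coordField z u k = Module.finBasis ℝ ℂ k :=
    congrArg (fun L : ℂ →L[ℝ] ℂ ↦ L (Module.finBasis ℝ ℂ k)) (mfderiv_id (I := 𝓘(ℝ, ℂ)) (x := u))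
  change inner ℝ (coordField z u i) (coordField z u j) = _
  rw [h, h]
  rfl

/-- The sum does not depend on the basis; in the orthonormal basis 1, i it is 1² + i² = 0. -/
theorem sum_inv_gram_smul_mul {ι : Type*} [Fintype ι] [DecidableEq ι] (b : Module.Basis ι ℝ ℂ) :
    ∑ i, ∑ j, (Matrix.gram ℝ b)⁻¹ i j • (b j * b i) = 0 := by
  open scoped Matrix in
  set P := Complex.basisOneI.toMatrix b
  set Q := b.toMatrix Complex.basisOneI
  have hG : Matrix.gram ℝ b = Pᵀ * P := by
    ext i j
    simp [P, Matrix.mul_apply, Module.Basis.toMatrix_apply, Matrix.gram_apply, Complex.inner]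
    ring
  have hQP : Q * P = 1 := Module.Basis.toMatrix_mul_toMatrix_flip _ _
  have hPQ : P * Q = 1 := Module.Basis.toMatrix_mul_toMatrix_flip _ _
  have hinv : (Matrix.gram ℝ b)⁻¹ = Q * Qᵀ := by
    refine Matrix.inv_eq_right_inv ?_
    rw [hG, Matrix.mul_assoc, ← Matrix.mul_assoc P, hPQ, Matrix.one_mul, ← Matrix.transpose_mul,
      hQP, Matrix.transpose_one]
  have hk (k : Fin 2) : ∑ i, Q i k • b i = Complex.basisOneI k :=
    b.sum_toMatrix_smul_self _ k
  have h1 : ∑ i, ∑ j, (Q * Qᵀ) i j • (b j * b i)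
      = ∑ k, (∑ i, Q i k • b i) * (∑ i, Q i k • b i) := by
    simp only [Matrix.mul_apply, Finset.sum_mul_sum, Finset.sum_smul, Matrix.transpose_apply]
    symm
    rw [Finset.sum_comm]
    refine Finset.sum_congr rfl fun i _ ↦ ?_
    rw [Finset.sum_comm]
    refine Finset.sum_congr rfl fun j _ ↦ Finset.sum_congr rfl fun k _ ↦ ?_
    simp only [Complex.real_smul]
    push_cast
    ring
  rw [hinv, h1, Fin.sum_univ_two, hk, hk]
  simp

/-- Chain rule with φ = `id`: its flux is constant, so its tension vanishes, and its gradient square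
is the sum above. -/
theorem tension_complex_analytic {F : ℂ → ℂ} {z : ℂ} (hF : AnalyticAt ℂ F z) :
    tension ℂ F z = 0 := by
  have hid : ContMDiffAt 𝓘(ℝ, ℂ) 𝓘(ℝ, ℂ) 2 (id : ℂ → ℂ) z := contMDiffAt_id
  have h1 := tension_comp_analytic (F := F) hid hF
  have hs : (id : ℂ → ℂ) ∘ (extChartAt 𝓘(ℝ, ℂ) z).symm = id := rfl
  have h2 : tension ℂ (id : ℂ → ℂ) z = 0 := by
    simp only [tension, metricMatrix_complex, hs, fderiv_id]
    simp
  have h3 : gradSq ℂ (id : ℂ → ℂ) z = 0 := by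
    simp only [gradSq, metricMatrix_complex, hs, fderiv_id]
    exact sum_inv_gram_smul_mul _
  rw [h2, h3] at h1
  simpa using h1

end Complex

theorem isPHarmonicOn_clm_comp_holomorphic {U : Set ℂ} (hU : IsOpen U) {F : ℂ → ℂ}
    (hF : DifferentiableOn ℂ F U) (ℓ : ℂ →L[ℝ] ℝ) : IsPHarmonicOn ℂ 1 (ℓ ∘ F) U := by
  have hA (z) (hz : z ∈ U) : AnalyticAt ℂ F z := hF.analyticAt (hU.mem_nhds hz)
  refine ⟨fun z hz ↦ ?_, fun z hz ↦ ?_⟩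
  · exact (ℓ.contDiff.contDiffAt.comp z
      (analyticAt_contDiffAt_real (hA z hz))).contMDiffAt.contMDiffWithinAt
  · have h := tension_clm_comp (E := ℂ) (f := F) ℓ
      (analyticAt_contDiffAt_real (hA z hz)).contMDiffAt
    rw [tension_complex_analytic (hA z hz), map_zero] at h
    exact h

/-! ### Horizontal weak conformality and the tension of holomorphic compositions. -/

section Main

variable {E : Type*} [NormedAddCommGroup E] [NormedSpace ℝ E] [FiniteDimensional ℝ E]
  {M : Type*} [TopologicalSpace M] [ChartedSpace E M] [IsManifold 𝓘(ℝ, E) 1 M]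
  [IsManifold 𝓘(ℝ, E) 4 M]
  [Bundle.RiemannianBundle (fun x : M ↦ TangentSpace 𝓘(ℝ, E) x)]
  [IsContMDiffRiemannianBundle 𝓘(ℝ, E) 3 E (fun x : M ↦ TangentSpace 𝓘(ℝ, E) x)]
  {V : Type*} [NormedAddCommGroup V] [NormedSpace ℝ V]
  {W : Type*} [NormedAddCommGroup W] [NormedSpace ℝ W]
  {φ : M → ℂ} {U : Set ℂ} {F : ℂ → ℂ}

theorem tension_clm_comp_eq {f : M → V} (ℓ : V →L[ℝ] W) (hf : ContMDiff 𝓘(ℝ, E) 𝓘(ℝ, V) 2 f) :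
    tension E (ℓ ∘ f) = ℓ ∘ tension E f :=
  funext fun p ↦ tension_clm_comp ℓ (hf p)

theorem tension_tension_clm_comp {f : M → V} (ℓ : V →L[ℝ] W)
    (hf : ContMDiff 𝓘(ℝ, E) 𝓘(ℝ, V) 4 f) (p : M) :
    tension E (tension E (ℓ ∘ f)) p = ℓ (tension E (tension E f) p) := by
  rw [tension_clm_comp_eq ℓ (hf.of_le (by norm_cast))]
  exact tension_clm_comp ℓ (contMDiff_tension hf p)

omit [FiniteDimensional ℝ E] [IsManifold 𝓘(ℝ, E) 1 M] [IsManifold 𝓘(ℝ, E) 4 M]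
  [Bundle.RiemannianBundle (fun x : M ↦ TangentSpace 𝓘(ℝ, E) x)]
  [IsContMDiffRiemannianBundle 𝓘(ℝ, E) 3 E (fun x : M ↦ TangentSpace 𝓘(ℝ, E) x)] in
theorem contMDiff_holomorphic_comp {k : ℕ∞ω} (hφ : ContMDiff 𝓘(ℝ, E) 𝓘(ℝ, ℂ) k φ)
    (hU : IsOpen U) (hφU : Set.range φ ⊆ U) (hF : DifferentiableOn ℂ F U) :
    ContMDiff 𝓘(ℝ, E) 𝓘(ℝ, ℂ) k (F ∘ φ) := fun p ↦
  (analyticAt_contDiffAt_real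
    (hF.analyticAt (hU.mem_nhds (hφU ⟨p, rfl⟩)))).contMDiffAt.comp p (hφ p)

omit [IsManifold 𝓘(ℝ, E) 1 M] [IsManifold 𝓘(ℝ, E) 4 M]
  [IsContMDiffRiemannianBundle 𝓘(ℝ, E) 3 E (fun x : M ↦ TangentSpace 𝓘(ℝ, E) x)] in
theorem IsHarmonicMorphism.contMDiff_four
    (hφ : IsHarmonicMorphism E ℂ 2 1 φ) : ContMDiff 𝓘(ℝ, E) 𝓘(ℝ, ℂ) 4 φ :=
  hφ.1

/-- A `(2, 1)`-harmonic morphism to `ℂ` pulls holomorphic functions back to biharmonic ones. -/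
theorem IsHarmonicMorphism.tension_tension_comp_holomorphic
    (hφ : IsHarmonicMorphism E ℂ 2 1 φ) (hU : IsOpen U) (hφU : Set.range φ ⊆ U)
    (hF : DifferentiableOn ℂ F U) (p : M) : tension E (tension E (F ∘ φ)) p = 0 := by
  have hpre : φ ⁻¹' U = Set.univ := Set.eq_univ_of_forall fun x ↦ hφU ⟨x, rfl⟩
  have key (ℓ : ℂ →L[ℝ] ℝ) : ℓ (tension E (tension E (F ∘ φ)) p) = 0 := by
    rw [← tension_tension_clm_comp ℓ (contMDiff_holomorphic_comp hφ.contMDiff_four hU hφU hF)]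
    exact (hφ.2 U _ hU ⟨p, hφU ⟨p, rfl⟩⟩ (isPHarmonicOn_clm_comp_holomorphic hU hF ℓ)).2 p
      (hφU ⟨p, rfl⟩)
  exact Complex.ext (key Complex.reCLM) (key Complex.imCLM)

/-- A `(2, 1)`-harmonic morphism to `ℂ` is horizontally weakly conformal. -/
theorem IsHarmonicMorphism.gradSq_eq_zero (hφ : IsHarmonicMorphism E ℂ 2 1 φ) (p : M) :
    gradSq E φ p = 0 := by
  have hφ4 := hφ.contMDiff_four
  have hφ2 : ContMDiff 𝓘(ℝ, E) 𝓘(ℝ, ℂ) 2 φ := hφ4.of_le (by norm_cast)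
  set a : ℂ := φ p
  have hd (n : ℕ) : deriv (fun z : ℂ ↦ (z - a) ^ (n + 1)) = fun z ↦ (n + 1) * (z - a) ^ n := by
    ext z
    simp
  -- With exponent 4 a double zero remains after one τ, so the second τ involves no derivatives of
  -- τ(φ) or `gradSq`.
  have hd4 : deriv (fun z : ℂ ↦ (z - a) ^ 4) = fun z ↦ 4 * (z - a) ^ 3 := by
    convert hd 3 using 3; norm_num
  have hd4' : deriv (fun z : ℂ ↦ 4 * (z - a) ^ 3) = fun z ↦ 12 * (z - a) ^ 2 := by
    ext z
    rw [deriv_const_mul_field, hd 2]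
    push_cast; ring
  have hd2 : deriv (fun z : ℂ ↦ (z - a) ^ 2) = fun z ↦ 2 * (z - a) := by
    convert hd 1 using 3 <;> norm_num
  have hd2' : deriv (fun z : ℂ ↦ 2 * (z - a)) = fun _ ↦ 2 := by
    ext z
    simp
  let h : M → ℂ := fun x ↦ 4 * (φ x - a) * tension E φ x + 12 * gradSq E φ x
  have h4 : tension E ((fun z ↦ (z - a) ^ 4) ∘ φ) = ((fun z ↦ (z - a) ^ 2) ∘ φ) * h := by
    ext x
    rw [tension_comp_analytic (hφ2 x) (by fun_prop), hd4, hd4']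
    simp only [h, Pi.mul_apply, Function.comp_apply]
    ring
  have hh : ContMDiff 𝓘(ℝ, E) 𝓘(ℝ, ℂ) 2 h := by
    have h3 : ContDiff ℝ 2 (fun x : ℂ × ℂ × ℂ ↦ 4 * (x.1 - a) * x.2.1 + 12 * x.2.2) := by
      fun_prop
    have h5 : ContMDiff 𝓘(ℝ, E) 𝓘(ℝ, ℂ × ℂ × ℂ) 2
        (fun x ↦ (φ x, tension E φ x, gradSq E φ x)) :=
      hφ2.prodMk_space ((contMDiff_tension hφ4).prodMk_space (contMDiff_gradSq hφ4))
    have h6 := h3.contMDiff.comp h5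
    exact h6
  have h0 := hφ.tension_tension_comp_holomorphic (F := fun z ↦ (z - a) ^ 4) isOpen_univ
    (Set.subset_univ _) (by fun_prop) p
  rw [h4, tension_comp_analytic_mul (hφ2 p) (hh p) (by fun_prop) (by simp [a])
    (by rw [hd2]; simp [a]), tension_comp_analytic (hφ2 p) (by fun_prop), hd2, hd2'] at h0
  -- At `p` the identity reads 12 S · 2 S = 0 with S = `gradSq E φ p`.
  simpa [h, a] using h0

theorem IsHarmonicMorphism.tension_comp_holomorphic
    (hφ : IsHarmonicMorphism E ℂ 2 1 φ) (hU : IsOpen U) (hφU : Set.range φ ⊆ U)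
    (hF : DifferentiableOn ℂ F U) (p : M) :
    tension E (F ∘ φ) p = deriv F (φ p) * tension E φ p := by
  rw [tension_comp_analytic ((hφ.contMDiff_four p).of_le (by norm_cast))
    (hF.analyticAt (hU.mem_nhds (hφU ⟨p, rfl⟩))), hφ.gradSq_eq_zero, mul_zero, add_zero]

end Main

end BiharmonicMorphism

theorem mainTheorem5
    {E : Type*} [NormedAddCommGroup E] [NormedSpace ℝ E] [FiniteDimensional ℝ E]
    {M : Type*} [TopologicalSpace M] [ChartedSpace E M] [IsManifold 𝓘(ℝ, E) 1 M]
    [IsManifold 𝓘(ℝ, E) 4 M]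
    [Bundle.RiemannianBundle (fun x : M ↦ TangentSpace 𝓘(ℝ, E) x)]
    [IsContMDiffRiemannianBundle 𝓘(ℝ, E) 3 E (fun x : M ↦ TangentSpace 𝓘(ℝ, E) x)]
    (φ : M → ℂ)
    (hsub : Manifold.IsSubmersion 𝓘(ℝ, E) 𝓘(ℝ, ℂ) 4 φ)
    (hφ : BiharmonicMorphism.IsHarmonicMorphism E ℂ 2 1 φ)
    (U : Set ℂ) (hU : IsOpen U) (hφU : Set.range φ ⊆ U)
    (F G : ℂ → ℂ) (hF : DifferentiableOn ℂ F U) (hG : DifferentiableOn ℂ G U)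
    (ψ : ℂ → ℂ) (hψ : ∀ z ∈ U, ψ z = F z + conj (G z)) :
    BiharmonicMorphism.IsPHarmonic E 2 (ψ ∘ φ) ∧
      (BiharmonicMorphism.IsProperPHarmonic E 2 (ψ ∘ φ) ↔
        ∃ x : M, deriv F (φ x) * BiharmonicMorphism.tension E φ x
          + conj (deriv G (φ x) * BiharmonicMorphism.tension E φ x) ≠ 0) := by
  open BiharmonicMorphism in
  -- The map (z, w) ↦ z + conj w is only real-linear, which suffices for it to commute with τ.
  let ℓ : ℂ × ℂ →L[ℝ] ℂ := ContinuousLinearMap.fst ℝ ℂ ℂ +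
    (Complex.conjCLE : ℂ →L[ℝ] ℂ) ∘L ContinuousLinearMap.snd ℝ ℂ ℂ
  let f : M → ℂ × ℂ := fun x ↦ (F (φ x), G (φ x))
  have hψφ : ψ ∘ φ = ℓ ∘ f := funext fun x ↦ hψ _ (hφU ⟨x, rfl⟩)
  have hFφ := contMDiff_holomorphic_comp hφ.contMDiff_four hU hφU hF
  have hGφ := contMDiff_holomorphic_comp hφ.contMDiff_four hU hφU hG
  have h24 : (2 : ℕ∞ω) ≤ 4 := by norm_cast
  have hf : ContMDiff 𝓘(ℝ, E) 𝓘(ℝ, ℂ × ℂ) 4 f := hFφ.prodMk_space hGφ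
  have hτf : tension E f = fun x ↦ (tension E (F ∘ φ) x, tension E (G ∘ φ) x) :=
    funext fun x ↦ tension_prodMk ((hFφ x).of_le h24) ((hGφ x).of_le h24)
  have hτ (x : M) : tension E (ψ ∘ φ) x =
      deriv F (φ x) * tension E φ x + conj (deriv G (φ x) * tension E φ x) := by
    rw [hψφ, tension_clm_comp ℓ ((hf x).of_le h24), hτf, ← hφ.tension_comp_holomorphic hU hφU hF,
      ← hφ.tension_comp_holomorphic hU hφU hG]
    rfl
  have hbi : IsPHarmonic E 2 (ψ ∘ φ) := by
    refine ⟨?_, fun x _ ↦ ?_⟩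
    · rw [hψφ]
      exact (ℓ.contDiff.contMDiff.comp hf).contMDiffOn
    · change tension E (tension E (ψ ∘ φ)) x = 0
      rw [hψφ, tension_tension_clm_comp ℓ hf, hτf,
        tension_prodMk (contMDiff_tension hFφ x) (contMDiff_tension hGφ x),
        hφ.tension_tension_comp_holomorphic hU hφU hF,
        hφ.tension_tension_comp_holomorphic hU hφU hG]
      exact map_zero ℓ
  refine ⟨hbi, ?_⟩
  simp only [← hτ]
  -- The iterate `(tension E)^[2 - 1]` unfolds to `tension E`, so properness is literally the
  -- nonvanishing of τ(ψ∘φ).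
  exact ⟨fun h ↦ h.2, fun h ↦ ⟨hbi, h⟩⟩
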